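/- Let $\mathbb F$ be an algebraically closed field of characteristic $p>0$ and let $X$ be a smooth variety over $\mathbb F$ (more generally, any smooth $\mathbb F$-scheme), not necessarily connected. Let $\omega_X$ be its canonical line bundle, i.e. $\omega_X=\Omega^n_X$ where $X$ has dimension $n$. Let $F$ be the absolute Frobenius of $X$ and put $\mathrm{End}_F(X)=\mathrm{Hom}_{\mathcal O_X}(F_*\mathcal O_X,\mathcal O_X)$; its elements are the additive sheaf maps $s:\mathcal O_X\to\mathcal O_X$ with $s(a^pb)=a\,s(b)$. Such an $s$ is a Frobenius splitting if the composite $\mathcal O_X\to F_*\mathcal O_X\xrightarrow{s}\mathcal O_X$ is the identity. Recall the natural isomorphism $\mathrm{End}_F(X)\cong\Gamma(X,\omega_X^{1-p})$, where $\omega_X^{1-p}=\mathcal Hom(\omega_X^{p},\omega_X)$: a section $\psi$ of $\omega_X^{1-p}$ corresponds to the $s$ given by $s(f)\,\tau=C(\text{class of }\psi(f\tau^{\otimes p}))$ for $\tau$ a local generator of $\omega_X$ and $f$ a local function. Here $C$ is the Cartier operator, the inverse of the $\mathcal O_X$-algebra isomorphism $c:\Omega_X^*\to\mathcal H^*_{\mathrm{dR}}$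 (functions $f$ acting on $\mathcal H^*_{\mathrm{dR}}$ as multiplication by $f^p$) with $c(df)=\text{class of }f^{p-1}df$. Let $\sigma\in\Gamma(X,\omega_X^{-1})$, where $\omega_X^{-1}=\mathcal Hom(\omega_X,\mathcal O_X)$, be such that $\sigma^{p-1}\in\Gamma(X,\omega_X^{1-p})$ defines, through this isomorphism, a Frobenius splitting $s$ of $X$. Then $s$ is compatible with the divisor $\mathrm{div}(\sigma)$ of $\sigma$: $s$ maps the ideal sheaf of $\mathrm{div}(\sigma)$, which is generated locally by $\sigma(\tau)$ for $\tau$ a local generator of $\omega_X$, into itself. -/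

import Mathlib

/-! ### The de Rham algebra of a commutative algebra -/

universe u

namespace FrobSplit

open scoped KaehlerDifferential

noncomputable section

section DeRham

/-- The algebra `Ω^* = ⨁ Ω^i` of differential forms of the commutative `R`-algebra `A`.
Its degree `n` part is the submodule `⋀[A]^n Ω[A⁄R]`. -/
abbrev Forms (R A : Type*) [CommRing R] [CommRing A] [Algebra R A] : Type _ :=
  ExteriorAlgebra A Ω[A⁄R]

/-- The sign involution `ω ↦ (-1) ^ i ω` for `ω` of degree `i`. -/
def sgn (R A : Type*) [CommRing R] [CommRing A] [Algebra R A] : Forms R A →ₐ[A] Forms R A :=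
  CliffordAlgebra.involute

/-- The one-form `da`, as an element of the algebra of forms. -/
def dd (R : Type*) {A : Type*} [CommRing R] [CommRing A] [Algebra R A] (a : A) : Forms R A :=
  ExteriorAlgebra.ι A (KaehlerDifferential.D R A a)

variable (R A : Type*) [CommRing R] [CommRing A] [Algebra R A]

variable {A} in
lemma dd_add (a b : A) : dd R (a + b) = dd R a + dd R b := by simp [dd]

variable {A} in
lemma dd_mul (a b : A) : dd R (a * b) = a • dd R b + b • dd R a := by simp [dd]

variable {A} in
lemma dd_pow (a : A) (n : ℕ) : dd R (a ^ n) = ((n : A) * a ^ (n - 1)) • dd R a := by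
  simp only [dd, Derivation.leibniz_pow, map_smul, map_nsmul]
  rw [mul_smul, Nat.cast_smul_eq_nsmul]

@[simp] lemma sgn_ι (m : Ω[A⁄R]) :
    sgn R A (ExteriorAlgebra.ι A m) = - ExteriorAlgebra.ι A m :=
  CliffordAlgebra.involute_ι m

@[simp] lemma sgn_sgn (x : Forms R A) : sgn R A (sgn R A x) = x :=
  CliffordAlgebra.involute_involute x

/-- Graded commutativity: `ω ∧ m = (-1)^i m ∧ ω` for a one-form `m`. -/
lemma ι_mul (m : Ω[A⁄R]) (x : Forms R A) :
    ExteriorAlgebra.ι A m * x = sgn R A x * ExteriorAlgebra.ι A m := by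
  induction x using ExteriorAlgebra.induction with
  | algebraMap r => simp [Algebra.commutes]
  | ι n =>
    rw [sgn_ι, neg_mul, eq_neg_iff_add_eq_zero, ExteriorAlgebra.ι_add_mul_swap]
  | mul a b ha hb => rw [← mul_assoc, ha, mul_assoc, hb, map_mul, mul_assoc]
  | add a b ha hb => rw [mul_add, ha, hb, map_add, add_mul]

/-- Auxiliary ring of matrices `!![± x, y; 0, x]` with `x y : Ω^*`. The assignment
`x ↦ !![± x, d x; 0, x]` is multiplicative exactly when `d` is an (anti)derivation, so that `d` can
be obtained from the universal properties of `Ω[A⁄R]` and of the exterior algebra. -/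
def auxSubring : Subring (Matrix (Fin 2) (Fin 2) (Forms R A)) where
  carrier := {M | M 1 0 = 0 ∧ M 0 0 = sgn R A (M 1 1)}
  mul_mem' := by
    rintro M N ⟨h1, h2⟩ ⟨h3, h4⟩
    simp [Matrix.mul_apply, Fin.sum_univ_two, h1, h2, h3, h4]
  one_mem' := by simp
  add_mem' := by
    rintro M N ⟨h1, h2⟩ ⟨h3, h4⟩
    simp [h1, h2, h3, h4]
  zero_mem' := by simp
  neg_mem' := by
    rintro M ⟨h1, h2⟩
    simp [h1, h2]

def Aux : Type _ := auxSubring R A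

instance : Ring (Aux R A) := inferInstanceAs (Ring (auxSubring R A))

variable {R A}

/-- The matrix `!![± x, y; 0, x]`. -/
def Aux.mk (x y : Forms R A) : Aux R A :=
  ⟨!![sgn R A x, y; 0, x], by simp [auxSubring]⟩

def Aux.fst (t : Aux R A) : Forms R A := t.1 1 1
def Aux.snd (t : Aux R A) : Forms R A := t.1 0 1

lemma Aux.ext {s t : Aux R A} (h1 : s.fst = t.fst) (h2 : s.snd = t.snd) : s = t := by
  apply Subtype.ext
  ext i j
  have hs := s.2
  have ht := t.2
  simp only [auxSubring] at hs ht
  obtain ⟨a, b⟩ := hs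
  obtain ⟨c, d⟩ := ht
  have h1' : s.1 1 1 = t.1 1 1 := h1
  have h2' : s.1 0 1 = t.1 0 1 := h2
  fin_cases i <;> fin_cases j
  · exact (b.trans (congrArg _ h1')).trans d.symm
  · exact h2'
  · exact a.trans c.symm
  · exact h1'

@[simp] lemma Aux.fst_mk (x y : Forms R A) : (Aux.mk x y).fst = x := rfl
@[simp] lemma Aux.snd_mk (x y : Forms R A) : (Aux.mk x y).snd = y := rfl
@[simp] lemma Aux.fst_add (s t : Aux R A) : (s + t).fst = s.fst + t.fst := rfl
@[simp] lemma Aux.snd_add (s t : Aux R A) : (s + t).snd = s.snd + t.snd := rfl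
@[simp] lemma Aux.fst_one : (1 : Aux R A).fst = 1 := rfl
@[simp] lemma Aux.snd_one : (1 : Aux R A).snd = 0 := rfl
@[simp] lemma Aux.fst_zero : (0 : Aux R A).fst = 0 := rfl
@[simp] lemma Aux.snd_zero : (0 : Aux R A).snd = 0 := rfl
@[simp] lemma Aux.fst_mul (s t : Aux R A) : (s * t).fst = s.fst * t.fst := by
  have h : (s * t).fst = s.1 1 0 * t.1 0 1 + s.1 1 1 * t.1 1 1 := by
    change (s.1 * t.1) 1 1 = _
    rw [Matrix.mul_apply, Fin.sum_univ_two]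
  rw [h, s.2.1, zero_mul, zero_add]; rfl
@[simp] lemma Aux.snd_mul (s t : Aux R A) :
    (s * t).snd = sgn R A s.fst * t.snd + s.snd * t.fst := by
  have h : (s * t).snd = s.1 0 0 * t.1 0 1 + s.1 0 1 * t.1 1 1 := by
    change (s.1 * t.1) 0 1 = _
    rw [Matrix.mul_apply, Fin.sum_univ_two]
  rw [h, s.2.2]; rfl

variable (R A)

/-- `a ↦ !![a, da; 0, a]`. -/
def Aux.ofBase : A →+* Aux R A where
  toFun a := Aux.mk (algebraMap A _ a) (dd R a)
  map_one' := by apply Aux.ext <;> simp [dd]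
  map_mul' a b := by
    apply Aux.ext
    · simp
    · simp only [Aux.snd_mk, Aux.snd_mul, Aux.fst_mk, AlgHom.commutes]
      rw [dd_mul, Algebra.smul_def, Algebra.smul_def, Algebra.commutes b]
  map_zero' := by apply Aux.ext <;> simp [dd]
  map_add' a b := by apply Aux.ext <;> simp [dd_add]

instance : Algebra A (Aux R A) :=
  (Aux.ofBase R A).toAlgebra' fun a t => by
    apply Aux.ext
    · simp only [Aux.fst_mul]
      exact Algebra.commutes a t.fst
    · simp only [Aux.ofBase, RingHom.coe_mk, MonoidHom.coe_mk, OneHom.coe_mk, Aux.snd_mul,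
        Aux.fst_mk, Aux.snd_mk, AlgHom.commutes, dd, ι_mul]
      rw [Algebra.commutes, add_comm]

instance : Module R (Aux R A) := Module.compHom _ (algebraMap R A)

instance : IsScalarTower R A (Aux R A) where
  smul_assoc r a t := by
    change (r • a) • t = (algebraMap R A r : A) • (a • t)
    rw [show r • a = algebraMap R A r * a from Algebra.smul_def r a]
    exact mul_smul _ _ t

variable {R A}

lemma Aux.smul_def' (a : A) (t : Aux R A) : a • t = Aux.ofBase R A a * t := rfl

@[simp] lemma Aux.fst_smul (a : A) (t : Aux R A) : (a • t).fst = a • t.fst := by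
  rw [Aux.smul_def', Aux.fst_mul, Algebra.smul_def]; rfl

@[simp] lemma Aux.snd_smul (a : A) (t : Aux R A) :
    (a • t).snd = a • t.snd + dd R a * t.fst := by
  rw [Aux.smul_def', Aux.snd_mul, Algebra.smul_def]
  simp [Aux.ofBase]

variable (R A)

/-- `b ↦ !![-db, 0; 0, db]`, reflecting that `d (db) = 0`. -/
def auxDer : Derivation R A (Aux R A) where
  toFun b := Aux.mk (dd R b) 0
  map_add' a b := by apply Aux.ext <;> simp [dd_add]
  map_smul' r b := by
    change Aux.mk (dd R (r • b)) 0 = (algebraMap R A r : A) • Aux.mk (dd R b) 0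
    have h : dd R (r • b) = (algebraMap R A r) • dd R b := by simp [dd]
    apply Aux.ext
    · rw [Aux.fst_smul]; exact h
    · rw [Aux.snd_smul]
      simp only [Aux.snd_mk, Aux.fst_mk, smul_zero, zero_add]
      simp [dd]
  map_one_eq_zero' := by
    apply Aux.ext <;> simp [dd]
  leibniz' a b := by
    apply Aux.ext
    · simp [dd_mul]
    · change (0 : Forms R A) = (a • Aux.mk (dd R b) 0 + b • Aux.mk (dd R a) 0 : Aux R A).snd
      simp only [Aux.snd_add, Aux.snd_smul, Aux.snd_mk,
        Aux.fst_mk, smul_zero, zero_add]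
      exact (ExteriorAlgebra.ι_add_mul_swap _ _).symm

def auxLift : Ω[A⁄R] →ₗ[A] Aux R A := (auxDer R A).liftKaehlerDifferential

variable {R A}

lemma fst_auxLift (m : Ω[A⁄R]) : (auxLift R A m).fst = ExteriorAlgebra.ι A m := by
  have hm : m ∈ Submodule.span A (Set.range (KaehlerDifferential.D R A)) := by
    rw [KaehlerDifferential.span_range_derivation]; trivial
  induction hm using Submodule.span_induction with
  | mem x hx =>
    obtain ⟨b, rfl⟩ := hx
    rw [auxLift, Derivation.liftKaehlerDifferential_comp_D]; rfl
  | zero => simp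
  | add x y _ _ hx hy => simp [hx, hy]
  | smul a x _ hx => simp [hx]

lemma snd_auxLift_comm (m n : Ω[A⁄R]) :
    ExteriorAlgebra.ι A n * (auxLift R A m).snd =
      (auxLift R A m).snd * ExteriorAlgebra.ι A n := by
  have hm : m ∈ Submodule.span A (Set.range (KaehlerDifferential.D R A)) := by
    rw [KaehlerDifferential.span_range_derivation]; trivial
  induction hm using Submodule.span_induction with
  | mem x hx =>
    obtain ⟨b, rfl⟩ := hx
    have : (auxLift R A (KaehlerDifferential.D R A b)).snd = 0 := by
      rw [auxLift, Derivation.liftKaehlerDifferential_comp_D]; rfl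
    simp [this]
  | zero => simp
  | add x y _ _ hx hy => simp [mul_add, add_mul, hx, hy]
  | smul a x _ hx =>
    simp only [map_smul, Aux.snd_smul, mul_add, add_mul, mul_smul_comm, smul_mul_assoc, hx,
      fst_auxLift, dd]
    rw [ι_mul]
    simp

/-- `x ↦ !![± x, d x; 0, x]`. -/
def auxHom (R A : Type*) [CommRing R] [CommRing A] [Algebra R A] : Forms R A →ₐ[A] Aux R A :=
  ExteriorAlgebra.lift A ⟨auxLift R A, fun m => by
    apply Aux.ext
    · simp [fst_auxLift]
    · simp [fst_auxLift, snd_auxLift_comm]⟩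

lemma fst_auxHom (x : Forms R A) : (auxHom R A x).fst = x := by
  induction x using ExteriorAlgebra.induction with
  | algebraMap r => rw [AlgHom.commutes]; rfl
  | ι m => rw [auxHom, ExteriorAlgebra.lift_ι_apply, fst_auxLift]
  | mul a b ha hb => simp [ha, hb]
  | add a b ha hb => simp [ha, hb]

variable (R A)

/-- The exterior derivative `d : Ω^* → Ω^*`. It is characterised by `extDer_algebraMap`,
`extDer_dd` and `extDer_mul` below. -/
def extDer : Forms R A →+ Forms R A where
  toFun x := (auxHom R A x).snd
  map_zero' := by simp
  map_add' := by simp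

variable {R A}

lemma extDer_algebraMap (a : A) : extDer R A (algebraMap A _ a) = dd R a := by
  change (auxHom R A (algebraMap A _ a)).snd = _
  rw [AlgHom.commutes]; rfl

lemma extDer_dd (a : A) : extDer R A (dd R a) = 0 := by
  change (auxHom R A (ExteriorAlgebra.ι A _)).snd = _
  rw [auxHom, ExteriorAlgebra.lift_ι_apply, auxLift,
    Derivation.liftKaehlerDifferential_comp_D]; rfl

/-- `d (x ∧ y) = dx ∧ y + (-1)^i x ∧ dy` for `x` of degree `i`. -/
lemma extDer_mul (x y : Forms R A) :
    extDer R A (x * y) = sgn R A x * extDer R A y + extDer R A x * y := by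
  change (auxHom R A (x * y)).snd = _
  rw [map_mul, Aux.snd_mul, fst_auxHom, fst_auxHom]; rfl

lemma extDer_one : extDer R A 1 = 0 := by
  simpa [dd] using extDer_algebraMap (R := R) (1 : A)

lemma extDer_smul (a : A) (x : Forms R A) :
    extDer R A (a • x) = a • extDer R A x + dd R a * x := by
  rw [Algebra.smul_def, extDer_mul, extDer_algebraMap, AlgHom.commutes, ← Algebra.smul_def]

/-- The algebra of forms is generated by the functions `a` and the one-forms `da`. -/
lemma forms_induction {P : Forms R A → Prop} (halg : ∀ a : A, P (algebraMap A _ a))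
    (hdd : ∀ a : A, P (dd R a)) (hmul : ∀ x y, P x → P y → P (x * y))
    (hadd : ∀ x y, P x → P y → P (x + y)) (x : Forms R A) : P x := by
  induction x using ExteriorAlgebra.induction with
  | algebraMap r => exact halg r
  | ι m =>
    have hm : m ∈ Submodule.span A (Set.range (KaehlerDifferential.D R A)) := by
      rw [KaehlerDifferential.span_range_derivation]; trivial
    induction hm using Submodule.span_induction with
    | mem x hx => obtain ⟨b, rfl⟩ := hx; exact hdd b
    | zero => simpa using halg 0
    | add x y _ _ hx hy => simpa using hadd _ _ hx hy
    | smul a x _ hx => simpa [Algebra.smul_def] using hmul _ _ (halg a) hx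
  | mul a b ha hb => exact hmul _ _ ha hb
  | add a b ha hb => exact hadd _ _ ha hb

lemma extDer_sgn (x : Forms R A) : extDer R A (sgn R A x) = - sgn R A (extDer R A x) := by
  induction x using forms_induction with
  | halg a => simp [extDer_algebraMap, dd]
  | hdd a =>
    have : sgn R A (dd R a) = - dd R a := sgn_ι _ _ _
    simp [this, extDer_dd]
  | hmul x y hx hy => simp [extDer_mul, hx, hy]; abel
  | hadd x y hx hy => simp [hx, hy]; abel

lemma extDer_extDer (x : Forms R A) : extDer R A (extDer R A x) = 0 := by
  induction x using forms_induction with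
  | halg a => simp [extDer_algebraMap, extDer_dd]
  | hdd a => simp [extDer_dd]
  | hmul x y hx hy => simp [extDer_mul, hx, hy, extDer_sgn]
  | hadd x y hx hy => simp [hx, hy]

variable (R A)

/-- The ring of closed forms. -/
def closedForms : Subring (Forms R A) where
  carrier := {x | extDer R A x = 0}
  mul_mem' := by
    intro x y hx hy
    simp only [Set.mem_ofPred_eq] at *
    simp [extDer_mul, hx, hy]
  one_mem' := extDer_one
  add_mem' := by
    intro x y hx hy
    simp only [Set.mem_ofPred_eq] at *
    simp [hx, hy]
  zero_mem' := by simp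
  neg_mem' := by
    intro x hx
    simp only [Set.mem_ofPred_eq] at *
    simp [hx]

/-- The ideal of exact forms in the ring of closed forms. -/
def exactForms : Ideal (closedForms R A) where
  carrier := {x | ∃ y, extDer R A y = x.1}
  add_mem' := by
    rintro x y ⟨a, ha⟩ ⟨b, hb⟩
    exact ⟨a + b, by simp [ha, hb]⟩
  zero_mem' := ⟨0, by simp⟩
  smul_mem' := by
    rintro ⟨z, hz⟩ x ⟨a, ha⟩
    change extDer R A z = 0 at hz
    exact ⟨sgn R A z * a, by simp [extDer_mul, extDer_sgn, hz, ha]⟩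

instance : (exactForms R A).IsTwoSided where
  mul_mem_of_left := by
    rintro x ⟨z, hz⟩ ⟨a, ha⟩
    change extDer R A z = 0 at hz
    exact ⟨a * z, by simp [extDer_mul, hz, ha]⟩

/-- The de Rham cohomology ring `H_dR^*` of `A` over `R`: closed forms modulo exact forms. -/
def DeRhamCoh : Type _ := closedForms R A ⧸ exactForms R A

instance : Ring (DeRhamCoh R A) :=
  inferInstanceAs (Ring (closedForms R A ⧸ exactForms R A))

/-- The cohomology class of a closed form. -/
def cohClass : closedForms R A →+* DeRhamCoh R A := Ideal.Quotient.mk (exactForms R A)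

variable {R A} in
lemma cohClass_eq_iff {x y : closedForms R A} :
    cohClass R A x = cohClass R A y ↔ ∃ z, extDer R A z = x.1 - y.1 :=
  Ideal.Quotient.eq

end DeRham

/-! ### The inverse Cartier operator -/

section Cartier

variable (p : ℕ) (R A : Type*) [CommRing R] [CommRing A] [Algebra R A]

/-- The de Rham cohomology ring, with the twisted `A`-algebra structure in which `a` acts as
multiplication by `a ^ p`. -/
@[nolint unusedArguments]
def TwCoh (_ : ℕ) (R A : Type*) [CommRing R] [CommRing A] [Algebra R A] : Type _ :=
  DeRhamCoh R A

instance : Ring (TwCoh p R A) := inferInstanceAs (Ring (DeRhamCoh R A))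

/-- The cohomology class of a closed form, in the twisted algebra. -/
def twClass : closedForms R A →+* TwCoh p R A := cohClass R A

variable {p R A}

/-- The coefficient `(p choose k) / p` of the polynomial `((X + Y)^p - X^p - Y^p) / p`. -/
lemma choose_div (hp : p.Prime) {k : ℕ} (h : k + 1 < p) :
    (k + 1) * (p.choose (k + 1) / p) = (p - 1).choose k ∧
      (p - (k + 1)) * (p.choose (k + 1) / p) = (p - 1).choose (k + 1) := by
  obtain ⟨m, hm⟩ := hp.dvd_choose_self (Nat.succ_ne_zero k) h
  obtain ⟨q, rfl⟩ : ∃ q, p = q + 1 := ⟨p - 1, by have := hp.pos; omega⟩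
  have h1 := Nat.add_one_mul_choose_eq q k
  have h3 := Nat.choose_mul_succ_eq q (k + 1)
  rw [Nat.succ_eq_add_one] at hm
  rw [hm] at h1 h3 ⊢
  rw [Nat.mul_div_cancel_left _ (Nat.succ_pos q)]
  simp only [Nat.add_sub_cancel] at *
  constructor
  · apply Nat.eq_of_mul_eq_mul_left (Nat.succ_pos q)
    rw [Nat.succ_eq_add_one, h1]; ring
  · apply Nat.eq_of_mul_eq_mul_left (Nat.succ_pos q)
    rw [Nat.succ_eq_add_one, mul_comm _ (q.choose (k + 1)), h3]; ring

/-- The closed one-form `a ^ (p - 1) da`. -/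
def gammaForm (p : ℕ) (R : Type*) {A : Type*} [CommRing R] [CommRing A] [Algebra R A] (a : A) :
    closedForms R A :=
  ⟨a ^ (p - 1) • dd R a, by
    change extDer R A _ = 0
    rw [extDer_smul, extDer_dd, smul_zero, zero_add, dd_pow, smul_mul_assoc]
    simp [dd]⟩

lemma gammaForm_add (hp : p.Prime) (a b : A) : ∃ y, extDer R A y =
    (gammaForm p R (a + b)).1 - ((gammaForm p R a).1 + (gammaForm p R b).1) := by
  obtain ⟨q, rfl⟩ : ∃ q, p = q + 1 := ⟨p - 1, by have := hp.pos; omega⟩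
  refine ⟨algebraMap A _ (∑ k ∈ Finset.range q,
    (((q + 1).choose (k + 1) / (q + 1) : ℕ) : A) * (a ^ (k + 1) * b ^ (q - k))), ?_⟩
  have key : ∀ k ∈ Finset.range q, dd R ((((q + 1).choose (k + 1) / (q + 1) : ℕ) : A) *
      (a ^ (k + 1) * b ^ (q - k))) =
      ((q.choose k : A) * a ^ k * b ^ (q - k)) • dd R a +
      ((q.choose (k + 1) : A) * a ^ (k + 1) * b ^ (q - (k + 1))) • dd R b := by
    intro k hk
    obtain ⟨h1, h2⟩ := choose_div hp (k := k) (by simpa using hk)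
    simp only [Nat.add_sub_cancel] at h1 h2
    have h0 : ∀ n : ℕ, dd R (n : A) = 0 := by intro n; simp [dd]
    rw [dd_mul, h0, smul_zero, add_zero, dd_mul, dd_pow, dd_pow, smul_add, smul_smul, smul_smul,
      smul_smul, smul_smul, ← h1, ← h2, add_comm]
    congr 2
    · push_cast; ring_nf
    · rw [show q + 1 - (k + 1) = q - k by omega, show q - k - 1 = q - (k + 1) by omega]
      push_cast; ring
  have hsum : ∀ (s : Finset ℕ) (f : ℕ → A), dd R (∑ k ∈ s, f k) = ∑ k ∈ s, dd R (f k) := by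
    intro s f; simp [dd]
  rw [extDer_algebraMap, hsum, Finset.sum_congr rfl key, Finset.sum_add_distrib,
    ← Finset.sum_smul, ← Finset.sum_smul]
  simp only [gammaForm, Nat.add_sub_cancel, dd_add, smul_add]
  have e1 : (a + b) ^ q = ∑ k ∈ Finset.range q, (q.choose k : A) * a ^ k * b ^ (q - k)
      + a ^ q := by
    rw [add_pow, Finset.sum_range_succ]
    simp [mul_comm, mul_left_comm, mul_assoc]
  have e2 : (a + b) ^ q = ∑ k ∈ Finset.range q,
      (q.choose (k + 1) : A) * a ^ (k + 1) * b ^ (q - (k + 1)) + b ^ q := by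
    rw [add_pow, Finset.sum_range_succ']
    simp [mul_comm, mul_left_comm, mul_assoc]
  nth_rewrite 1 [e1]
  rw [e2, add_smul, add_smul]
  abel

variable (p R A) [hp : Fact p.Prime] [CharP R p]

lemma cast_p (p : ℕ) (R A : Type*) [CommRing R] [CommRing A] [Algebra R A] [CharP R p] :
    (p : A) = 0 := by
  rw [← map_natCast (algebraMap R A), CharP.cast_eq_zero, map_zero]

/-- The functions `a ^ p` are closed. -/
def powClosed : A →+* closedForms R A where
  toFun a := ⟨algebraMap A _ (a ^ p), by
    change extDer R A _ = 0
    rw [extDer_algebraMap, dd_pow, cast_p p R A, zero_mul, zero_smul]⟩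
  map_one' := by ext; simp
  map_mul' a b := by ext; simp [mul_pow]
  map_zero' := by ext; simp [hp.out.ne_zero]
  map_add' a b := by
    apply Subtype.ext
    obtain ⟨r, hr⟩ := exists_add_pow_prime_eq hp.out a b
    have hpA : (p : Forms R A) = 0 := by
      rw [← map_natCast (algebraMap A (Forms R A)), cast_p p R A, map_zero]
    simp [hr, hpA]

instance : Algebra A (TwCoh p R A) :=
  ((twClass p R A).comp (powClosed p R A)).toAlgebra' fun a t => by
    obtain ⟨z, rfl⟩ := Ideal.Quotient.mk_surjective (I := exactForms R A) t
    change twClass p R A _ * twClass p R A z = twClass p R A z * twClass p R A _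
    rw [← map_mul, ← map_mul]
    congr 1
    apply Subtype.ext
    exact Algebra.commutes (A := Forms R A) _ _

instance : Module R (TwCoh p R A) := Module.compHom _ (algebraMap R A)

instance : IsScalarTower R A (TwCoh p R A) where
  smul_assoc r a t := by
    change (r • a) • t = (algebraMap R A r : A) • (a • t)
    rw [show r • a = algebraMap R A r * a from Algebra.smul_def r a]
    exact mul_smul _ _ t

variable {p R A}

lemma smul_twClass (a : A) (z : closedForms R A) :
    a • twClass p R A z = twClass p R A (powClosed p R A a * z) := by
  rw [map_mul]; rfl

variable (p R A)

/-- The derivation `γ : a ↦ class of a ^ (p - 1) da` from `A` to the twisted cohomology. -/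
def gamma : Derivation R A (TwCoh p R A) where
  toFun a := twClass p R A (gammaForm p R a)
  map_add' a b := by
    rw [← map_add]
    exact cohClass_eq_iff.mpr (gammaForm_add hp.out a b)
  map_smul' r a := by
    change _ = (algebraMap R A r : A) • twClass p R A (gammaForm p R a)
    rw [smul_twClass]
    congr 1
    apply Subtype.ext
    obtain ⟨q, hq⟩ : ∃ q, p = q + 1 := ⟨p - 1, by have := hp.out.pos; omega⟩
    simp only [gammaForm, powClosed, Subring.coe_mul, RingHom.coe_mk, MonoidHom.coe_mk,
      OneHom.coe_mk, ← Algebra.smul_def, smul_smul]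
    have : dd R (r • a) = (algebraMap R A r) • dd R a := by simp [dd]
    rw [this, smul_smul]
    congr 1
    rw [hq, Nat.add_sub_cancel, Algebra.smul_def]
    ring
  map_one_eq_zero' := by
    have : gammaForm p R (1 : A) = 0 := by
      apply Subtype.ext
      simp [gammaForm, dd]
    simp [this]
  leibniz' a b := by
    simp only [LinearMap.coe_mk, AddHom.coe_mk]
    rw [smul_twClass, smul_twClass, ← map_add]
    congr 1
    apply Subtype.ext
    obtain ⟨q, hq⟩ : ∃ q, p = q + 1 := ⟨p - 1, by have := hp.out.pos; omega⟩
    simp only [gammaForm, powClosed, Subring.coe_mul, Subring.coe_add, RingHom.coe_mk,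
      MonoidHom.coe_mk, OneHom.coe_mk, ← Algebra.smul_def, smul_smul, dd_mul, smul_add]
    congr 2 <;> rw [hq, Nat.add_sub_cancel] <;> ring

variable {p R A}

lemma gammaLift_mem (m : Ω[A⁄R]) : ∃ (n : Ω[A⁄R]) (h : _),
    (gamma p R A).liftKaehlerDifferential m =
      twClass p R A ⟨ExteriorAlgebra.ι A n, h⟩ := by
  have hm : m ∈ Submodule.span A (Set.range (KaehlerDifferential.D R A)) := by
    rw [KaehlerDifferential.span_range_derivation]; trivial
  induction hm using Submodule.span_induction with
  | mem x hx =>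
    obtain ⟨b, rfl⟩ := hx
    rw [Derivation.liftKaehlerDifferential_comp_D]
    refine ⟨b ^ (p - 1) • KaehlerDifferential.D R A b, ?_, ?_⟩
    · rw [map_smul]; exact (gammaForm p R b).2
    · change twClass p R A (gammaForm p R b) = _
      congr 1
      apply Subtype.ext
      simp [gammaForm, dd]
  | zero =>
    refine ⟨0, by rw [map_zero]; exact Subring.zero_mem _, ?_⟩
    rw [map_zero, ← map_zero (twClass p R A)]
    congr 1
    apply Subtype.ext
    simp
  | add x y _ _ hx hy =>
    obtain ⟨n, hn, hx⟩ := hx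
    obtain ⟨n', hn', hy⟩ := hy
    refine ⟨n + n', by rw [map_add]; exact Subring.add_mem _ hn hn', ?_⟩
    rw [map_add, hx, hy, ← map_add]
    congr 1
    apply Subtype.ext
    simp
  | smul a x _ hx =>
    obtain ⟨n, hn, hx⟩ := hx
    have e : ExteriorAlgebra.ι A (a ^ p • n) = (powClosed p R A a * ⟨_, hn⟩ : closedForms R A) := by
      simp [powClosed, Algebra.smul_def]
    refine ⟨a ^ p • n, by rw [e]; exact Subtype.prop _, ?_⟩
    rw [map_smul, hx, smul_twClass]
    congr 1
    exact Subtype.ext e.symm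

variable (p R A)

/-- The inverse Cartier operator: the homomorphism of `A`-algebras `c : Ω^* → H_dR^*` induced by
the derivation `γ`. So `c (a db₁ ∧ ⋯ ∧ dbₙ)` is the class of
`a ^ p (b₁ ⋯ bₙ) ^ (p - 1) db₁ ∧ ⋯ ∧ dbₙ`.
When `c` is bijective (for instance if `A` is smooth over a perfect field `R` of characteristic `p`)
its inverse is the Cartier operator `C`; thus `C h = ω` if and only if `c ω = h`. -/
def invCartier : Forms R A →ₐ[A] TwCoh p R A :=
  ExteriorAlgebra.lift A ⟨(gamma p R A).liftKaehlerDifferential, fun m => by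
    obtain ⟨n, hn, h⟩ := gammaLift_mem (p := p) m
    rw [h, ← map_mul, ← map_zero (twClass p R A)]
    congr 1
    apply Subtype.ext
    simp⟩

/-- `IsCartier p R A η ω` says that the form `η` is closed and that `C (class of η) = ω`, where `C`
is the Cartier operator. -/
def IsCartier (η ω : Forms R A) : Prop :=
  ∃ h : η ∈ closedForms R A, invCartier p R A ω = twClass p R A ⟨η, h⟩

end Cartier

/-! ### Sections of the powers of a dual line bundle -/

section Power

open scoped TensorProduct

variable {A L : Type*} [CommRing A] [AddCommGroup L] [Module A L]

/-- For `σ : L → A` (a section of the dual `L⁻¹`), its power `σ ^ m`, regarded as the map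
`L^⊗(m+1) → L`, `τ₀ ⊗ ⋯ ⊗ τₘ ↦ σ(τ₀) ⋯ σ(τₘ₋₁) τₘ`. -/
def dualPowSucc (m : ℕ) (σ : L →ₗ[A] A) : (⨂[A]^(m + 1) L) →ₗ[A] L :=
  PiTensorProduct.lift
    (MultilinearMap.uncurryRight
      ((LinearMap.lsmul A L : A →ₗ[A] L →ₗ[A] L).compMultilinearMap
        ((MultilinearMap.mkPiAlgebra A (Fin m) A).compLinearMap fun _ => σ)))

/-- For `σ : L → A` and `p ≥ 1`, the section `σ ^ (p - 1)` of `L^(1-p) = Hom(L^⊗p, L)`. -/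
def dualPow (p : ℕ) [hp : Fact p.Prime] (σ : L →ₗ[A] A) : (⨂[A]^p L) →ₗ[A] L :=
  (dualPowSucc (p - 1) σ).comp
    (TensorPower.cast A L (Nat.sub_add_cancel hp.out.one_le).symm).toLinearMap

end Power

/-! ### Twisted endomorphisms, sections of the anticanonical bundle, and their divisors -/

section Geometry

open AlgebraicGeometry CategoryTheory
open scoped TensorProduct

/-- `End_φ(A)`: additive maps `s : A → A` with `s (a ^ p * b) = a * s b`. -/
structure TwistedEnd (p : ℕ) (A : Type*) [CommRing A] extends A →+ A where
  map_pow_mul' : ∀ a b : A, toFun (a ^ p * b) = a * toFun b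

/-- The restriction map `Γ(X, U) → Γ(X, V)` for `V ≤ U`. -/
def res {X : Scheme.{u}} {U V : X.Opens} (h : V ≤ U) : Γ(X, U) →+* Γ(X, V) :=
  (X.presheaf.map (homOfLE h).op).hom

/-- `End_F(X) = Hom(F_* O_X, O_X)` for `F` the absolute Frobenius: a twisted endomorphism of
`Γ(X, U)` for every open `U`, compatibly with restriction. -/
structure FrobEnd (p : ℕ) (X : Scheme.{u}) where
  app (U : X.Opens) : TwistedEnd p Γ(X, U)
  naturality {U V : X.Opens} (h : V ≤ U) (a : Γ(X, U)) :
    res h ((app U).toAddMonoidHom a) = (app V).toAddMonoidHom (res h a)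

/-- `s : F_* O_X → O_X` is a Frobenius splitting: `O_X → F_* O_X → O_X` is the identity. -/
def FrobEnd.IsSplitting {p : ℕ} {X : Scheme.{u}} (s : FrobEnd p X) : Prop :=
  ∀ (U : X.Opens) (a : Γ(X, U)), (s.app U).toAddMonoidHom (a ^ p) = a

/-- `s` maps the sheaf of ideals `I` to itself. -/
def FrobEnd.IsCompatible {p : ℕ} {X : Scheme.{u}} (s : FrobEnd p X)
    (I : ∀ U : X.Opens, Ideal Γ(X, U)) : Prop :=
  ∀ (U : X.Opens), ∀ a ∈ I U, (s.app U).toAddMonoidHom a ∈ I U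

variable (F : Type u) [Field F] (X : Scheme.{u}) [X.Over (Spec (.of F))]

instance sectionsAlgebra (U : X.Opens) : Algebra F Γ(X, U) :=
  ((Scheme.ΓSpecIso (.of F)).inv ≫ (X ↘ Spec (.of F)).appLE ⊤ U
    (by rw [Scheme.Hom.preimage_top]; exact le_top)).hom.toAlgebra

/-- Affine open subsets `U` of `X` on which `Ω_X` has rank `n` at every point. When `X` is smooth
these are the affine open subsets of pure dimension `n`; every point of `X` has arbitrarily small
neighbourhoods of this kind for exactly one `n`. -/
structure PureAffine (n : ℕ) where
  U : X.Opens
  isAffine : IsAffineOpen U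
  rank : ∀ x : PrimeSpectrum Γ(X, U), Module.rankAtStalk (R := Γ(X, U)) Ω[Γ(X, U)⁄F] x = n

variable {F X}

/-- The sections over `U` of the canonical bundle `ω_X = Ω_X^n`. -/
abbrev PureAffine.can {n : ℕ} (U : PureAffine F X n) : Submodule Γ(X, U.U) (Forms F Γ(X, U.U)) :=
  ⋀[Γ(X, U.U)]^n Ω[Γ(X, U.U)⁄F]

/-- The `n`-form `dx₁ ∧ ⋯ ∧ dxₙ` on `U`. -/
def PureAffine.wedge {n : ℕ} (U : PureAffine F X n) (x : Fin n → Γ(X, U.U)) : U.can :=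
  exteriorPower.ιMulti Γ(X, U.U) n fun i => KaehlerDifferential.D F Γ(X, U.U) (x i)

/-- `τ` generates the canonical bundle on `U`. -/
def PureAffine.IsGenerator {n : ℕ} (U : PureAffine F X n) (τ : U.can) : Prop :=
  Submodule.span Γ(X, U.U) {τ} = ⊤

variable (F X)

/-- A global section of `ω_X⁻¹ = Hom(ω_X, O_X)`, for `X` smooth over `F`: a linear map from the
sections of `ω_X` to those of `O_X` over each affine open subset of pure dimension, compatibly with
restriction. As the forms `dx₁ ∧ ⋯ ∧ dxₙ` with `xᵢ ∈ Γ(X, U)` generate `Γ(U, ω_X)`, the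
compatibility with restriction is expressed on these forms. -/
structure AnticanonicalSection where
  app {n : ℕ} (U : PureAffine F X n) : U.can →ₗ[Γ(X, U.U)] Γ(X, U.U)
  naturality {n : ℕ} {U V : PureAffine F X n} (h : V.U ≤ U.U) (x : Fin n → Γ(X, U.U)) :
    res h (app U (U.wedge x)) = app V (V.wedge fun i => res h (x i))

variable {F X}

/-- The ideal sheaf of the divisor `div σ`: a section belongs to it if it is locally divisible by
the local equation `σ(τ)` of `div σ`, where `τ` is a local generator of `ω_X` (so that
`σ = σ(τ) τ⁻¹`). -/
def AnticanonicalSection.divIdeal (σ : AnticanonicalSection F X) (U : X.Opens) :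
    Ideal Γ(X, U) :=
  ⨅ (n : ℕ) (V : PureAffine F X n) (h : V.U ≤ U) (τ : V.can) (_ : V.IsGenerator τ),
    (Ideal.span {σ.app V τ}).comap (res h)

/-- The twisted endomorphism `s` of `O_X` corresponds, under the natural isomorphism
`End_F(X) ≅ ω_X^(1-p) = Hom(ω_X^p, ω_X)`, to the section of `ω_X^(1-p)` that is given on `U` by
`ψ U`: if `τ` is a local generator of `ω_X` and `f` a function then
`s(f) τ = C (class of ψ (f τ^⊗p))`, where `C` is the Cartier operator. -/
def FrobEnd.CorrespondsTo {p : ℕ} [Fact p.Prime] [CharP F p] (s : FrobEnd p X)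
    (ψ : ∀ {n : ℕ} (U : PureAffine F X n), (⨂[Γ(X, U.U)]^p U.can) →ₗ[Γ(X, U.U)] U.can) : Prop :=
  ∀ {n : ℕ} (U : PureAffine F X n) (τ : U.can), U.IsGenerator τ → ∀ f : Γ(X, U.U),
    IsCartier p F Γ(X, U.U)
      (ψ U (f • PiTensorProduct.tprod Γ(X, U.U) fun _ : Fin p => τ) : Forms F Γ(X, U.U))
      ((s.app U.U).toAddMonoidHom f • (τ : Forms F Γ(X, U.U)))

/-- The section `σ ^ (p - 1)` of `ω_X^(1-p)` defines the twisted endomorphism `s` of `O_X`. -/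
def AnticanonicalSection.PowDefines (σ : AnticanonicalSection F X) {p : ℕ} [Fact p.Prime]
    [CharP F p] (s : FrobEnd p X) : Prop :=
  s.CorrespondsTo fun U => dualPow p (σ.app U)

end Geometry

end

end FrobSplit

/-! On an affine open set with generator `τ` of the canonical bundle, put `g = σ(τ)`. A section of
the ideal restricts to some `g c`, and `f = s(g c)` satisfies `f τ = C(g ^ (p - 1) g c τ) = C(g ^ p
c τ)`. Formally this is `g C(c τ)`, whence `g ∣ f`. But `C` enters only as a relation, through its
inverse `c`, so a form `C(c τ)` is not at hand, and the divisibility is proved without bijectivity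
of the inverse Cartier operator.

In local coordinates `x₁, …, xₙ` write `dx₁ ∧ ⋯ ∧ dxₙ = w τ`. Computing the inverse Cartier operator
on `f dx₁ ∧ ⋯ ∧ dxₙ` in two ways shows that `f ^ p (x₁ ⋯ xₙ) ^ (p - 1) dx₁ ∧ ⋯ ∧ dxₙ` and `w ^ p g ^
p c τ` differ by an exact form (`IsCartier.exists_extDer_eq`). The operator `∏ ∂ᵢ ^ (p - 1)`,
applied to top coefficients, kills exact forms (`topDiffOp_topCoeff_extDer`), is linear over `p`-th
powers, and sends `(x₁ ⋯ xₙ) ^ (p - 1)` to the unit `(p - 1)! ^ n`. Hence `g ^ p ∣ f ^ p` on the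
chart (`IsCartier.pow_dvd_pow_of_coordinates`).

The splitting extracts the root: `f ^ p = g ^ p v` gives `f = s(f ^ p) = g s(v)`. Smoothness
provides enough charts to cover the affine set, and `IsCartier.dvd` glues. -/

namespace FrobSplit

open scoped KaehlerDifferential

/-! ### Iterates of a derivation in characteristic `p`. -/

section IteratedDerivation

variable {R B : Type*} [CommRing R] [CommRing B] [Algebra R B]

lemma derivation_iterate_mul (D : Derivation R B B) (k : ℕ) (a c : B) :
    ((D : B →ₗ[R] B) ^ k) (a * c) = ∑ ij ∈ Finset.HasAntidiagonal.antidiagonal k,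
      (k.choose ij.1 : B) * (((D : B →ₗ[R] B) ^ ij.1) a * ((D : B →ₗ[R] B) ^ ij.2) c) := by
  induction k with
  | zero => simp
  | succ k ih =>
    rw [pow_succ', Module.End.mul_apply, ih, map_sum, Finset.sum_antidiagonal_choose_succ_mul
      (fun i j => ((D : B →ₗ[R] B) ^ i) a * ((D : B →ₗ[R] B) ^ j) c), ← Finset.sum_add_distrib]
    refine Finset.sum_congr rfl fun ij hij => ?_
    rw [Nat.choose_symm_of_eq_add (Finset.HasAntidiagonal.mem_antidiagonal.1 hij).symm, pow_succ',
      pow_succ', Module.End.mul_apply, Module.End.mul_apply]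
    simp [Derivation.leibniz]
    ring

lemma derivation_iterate_pow (D : Derivation R B B) {x : B} (hx : D x = 1) (m k : ℕ) :
    ((D : B →ₗ[R] B) ^ k) (x ^ m) = (m.descFactorial k : B) * x ^ (m - k) := by
  induction k with
  | zero => simp
  | succ k ih =>
    rw [pow_succ', Module.End.mul_apply, ih, Nat.descFactorial_succ]
    simp [Derivation.leibniz, Derivation.leibniz_pow, hx]
    rw [Nat.sub_sub]
    ring

variable (p : ℕ) [Fact p.Prime] [CharP R p]

/-- In characteristic `p`, the `p`-th iterate of a derivation is a derivation. -/
noncomputable def derivationPowChar (D : Derivation R B B) : Derivation R B B :=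
  Derivation.mk' ((D : B →ₗ[R] B) ^ p) fun a c => by
    have hp : p.Prime := Fact.out
    -- Only the two extreme terms of the Leibniz formula survive, because `p` divides every interior
    -- binomial coefficient.
    rw [derivation_iterate_mul, Finset.Nat.sum_antidiagonal_eq_sum_range_succ_mk,
      Finset.sum_range_succ, ← Finset.sum_erase_add _ _ (Finset.mem_range.2 hp.pos),
      Finset.sum_eq_zero]
    · simp
      ring
    · intro k hk
      simp only [Finset.mem_erase, Finset.mem_range] at hk
      obtain ⟨m, hm⟩ := hp.dvd_choose_self hk.1 hk.2
      simp [hm, cast_p p R B]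

lemma derivationPowChar_apply (D : Derivation R B B) (a : B) :
    derivationPowChar p D a = ((D : B →ₗ[R] B) ^ p) a := rfl

end IteratedDerivation

/-! ### Partial derivatives attached to a basis of exact differentials. -/

section Coordinates

variable {R B : Type*} [CommRing R] [CommRing B] [Algebra R B] {n : ℕ}
  (b : Module.Basis (Fin n) B Ω[B⁄R])

/-- The partial derivative with respect to the `i`-th element of a basis of `Ω[B⁄R]`. -/
noncomputable def partialDer (i : Fin n) : Derivation R B B :=
  (b.coord i).compDer (KaehlerDifferential.D R B)

variable {b} {x : Fin n → B} (hx : ∀ i, b i = KaehlerDifferential.D R B (x i))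

lemma partialDer_apply_coordinate (hx : ∀ i, b i = KaehlerDifferential.D R B (x i))
    (i j : Fin n) : partialDer b i (x j) = if j = i then 1 else 0 := by
  change b.coord i (KaehlerDifferential.D R B (x j)) = _
  rw [← hx, b.coord_apply, b.repr_self, Finsupp.single_apply]

lemma dd_eq_sum_partialDer (hx : ∀ i, b i = KaehlerDifferential.D R B (x i)) (a : B) :
    dd R a = ∑ i, partialDer b i a • dd R (x i) := by
  have h := congrArg (ExteriorAlgebra.ι B) (b.sum_repr (KaehlerDifferential.D R B a))
  rw [map_sum] at h
  rw [dd, ← h]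
  refine Finset.sum_congr rfl fun i _ => ?_
  rw [map_smul, hx]
  rfl

include hx in
-- A derivation factors through the differentials, which the `dxᵢ` generate. Identities between
-- derivations can therefore be tested on coordinates, as is done below for `[∂ᵢ, ∂ⱼ] = 0` and `∂ᵢ ^
-- p = 0`.
lemma derivation_eq_zero_of_coordinates (D : Derivation R B B) (h : ∀ i, D (x i) = 0) : D = 0 := by
  have h0 : D.liftKaehlerDifferential = 0 := b.ext fun i => by
    rw [hx, Derivation.liftKaehlerDifferential_comp_D, h, LinearMap.zero_apply]
  ext a
  rw [← D.liftKaehlerDifferential_comp_D, h0]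
  rfl

include hx in
lemma commute_partialDer (i j : Fin n) :
    Commute (partialDer b i : B →ₗ[R] B) (partialDer b j : B →ₗ[R] B) := by
  have h : ⁅partialDer b i, partialDer b j⁆ = 0 :=
    derivation_eq_zero_of_coordinates hx _ fun k => by
      rw [Derivation.commutator_apply, partialDer_apply_coordinate hx,
        partialDer_apply_coordinate hx]
      split_ifs <;> simp
  refine LinearMap.ext fun a => ?_
  have := DFunLike.congr_fun h a
  rw [Derivation.commutator_apply] at this
  exact sub_eq_zero.1 this

include hx in
lemma partialDer_pow_char (p : ℕ) [Fact p.Prime] [CharP R p] (i : Fin n) :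
    (partialDer b i : B →ₗ[R] B) ^ p = 0 := by
  have h : derivationPowChar p (partialDer b i) = 0 :=
    derivation_eq_zero_of_coordinates hx _ fun k => by
      -- As `p ≥ 2`, two derivatives can be split off: the first makes a coordinate `0` or `1`, the
      -- second kills it.
      obtain ⟨q, hq⟩ : ∃ q, p = q + 2 := ⟨p - 2, by have := (Fact.out : p.Prime).two_le; omega⟩
      rw [derivationPowChar_apply]
      subst hq
      rw [pow_succ, pow_succ, Module.End.mul_apply, Module.End.mul_apply,
        Derivation.coeFn_coe, partialDer_apply_coordinate hx]
      split_ifs <;> simp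
  refine LinearMap.ext fun a => ?_
  exact DFunLike.congr_fun h a

lemma commute_mulLeft_derivation (D : Derivation R B B) {c : B} (hc : D c = 0) :
    Commute (LinearMap.mulLeft R c) (D : B →ₗ[R] B) :=
  LinearMap.ext fun a => by simp [Derivation.leibniz, hc]

/-! ### The operator `∏ ∂ᵢ ^ (p - 1)`. -/

section Trace

variable (p : ℕ)

include hx in
lemma pairwise_commute_partialDer_pow (s : Finset (Fin n)) :
    (s : Set (Fin n)).Pairwise
      (Function.onFun Commute fun i => (partialDer b i : B →ₗ[R] B) ^ (p - 1)) :=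
  fun i _ j _ _ => (commute_partialDer hx i j).pow_pow _ _

/-- The product of the operators `∂ᵢ ^ (p - 1)` over all `i` in `s`. -/
noncomputable def topDiffOp (hx : ∀ i, b i = KaehlerDifferential.D R B (x i))
    (s : Finset (Fin n)) : Module.End R B :=
  s.noncommProd (fun i => (partialDer b i : B →ₗ[R] B) ^ (p - 1))
    (pairwise_commute_partialDer_pow hx p s)

lemma topDiffOp_mul_of_constant (s : Finset (Fin n)) {c : B}
    (hc : ∀ i ∈ s, partialDer b i c = 0) (a : B) :
    topDiffOp p hx s (c * a) = c * topDiffOp p hx s a := by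
  have h : Commute (LinearMap.mulLeft R c) (topDiffOp p hx s) :=
    Finset.noncommProd_commute _ _ _ _ fun i hi =>
      (commute_mulLeft_derivation _ (hc i hi)).pow_right _
  exact (LinearMap.congr_fun h.eq a).symm

/-- The factors commute, so `∂ᵢ ^ (p - 1)` can be moved next to the extra `∂ᵢ`, where it forms `∂ᵢ ^
p = 0`. -/
lemma topDiffOp_partialDer [Fact p.Prime] [CharP R p] (i : Fin n) (a : B) :
    topDiffOp p hx Finset.univ (partialDer b i a) = 0 := by
  have h : topDiffOp p hx Finset.univ * (partialDer b i : B →ₗ[R] B) = 0 := by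
    rw [topDiffOp, ← Finset.noncommProd_erase_mul _ (Finset.mem_univ i), mul_assoc, ← pow_succ,
      Nat.sub_add_cancel (Fact.out : p.Prime).one_le, partialDer_pow_char hx, mul_zero]
  exact LinearMap.congr_fun h a

/-- The variables separate: `xⱼ ^ (p - 1)` is a constant for every `∂ᵢ` with `i ≠ j`, and `∂ⱼ ^ (p -
1)` turns it into `(p - 1)!`. -/
lemma topDiffOp_prod_coordinates (s : Finset (Fin n)) :
    topDiffOp p hx s (∏ i ∈ s, x i ^ (p - 1)) = ((p - 1).factorial : B) ^ s.card := by
  induction s using Finset.induction_on with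
  | empty => simp [topDiffOp]
  | insert j s hj ih =>
    have h : topDiffOp p hx (insert j s) =
        (partialDer b j : B →ₗ[R] B) ^ (p - 1) * topDiffOp p hx s :=
      Finset.noncommProd_insert_of_notMem _ _ _ _ hj
    rw [h, Module.End.mul_apply, Finset.prod_insert hj, topDiffOp_mul_of_constant, ih,
      Finset.card_insert_of_notMem hj, pow_succ', mul_comm, ← Nat.cast_pow, ← nsmul_eq_mul,
      map_nsmul, derivation_iterate_pow _ (by simp [partialDer_apply_coordinate hx]),
      Nat.descFactorial_self]
    · simp [mul_comm]
    · intro i hi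
      have : j ≠ i := fun e => hj (e ▸ hi)
      simp [Derivation.leibniz_pow, partialDer_apply_coordinate hx, this]

end Trace

/-! ### Coefficients of top forms, and their vanishing on exact forms. -/

section TopCoefficient

variable (b)

/-- The coefficient of `b₁ ∧ ⋯ ∧ bₙ` in a differential form. -/
noncomputable def topCoeff : Forms R B →ₗ[B] B :=
  ExteriorAlgebra.liftAlternating (Pi.single n b.det)

lemma topCoeff_ιMulti (v : Fin n → Ω[B⁄R]) :
    topCoeff b (ExteriorAlgebra.ιMulti B n v) = b.det v := by
  rw [topCoeff, ExteriorAlgebra.liftAlternating_apply_ιMulti, Pi.single_eq_same]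

variable {b}

lemma extDer_eq_zero_of_mem_closure {m : Forms R B}
    (hm : m ∈ Submonoid.closure (Set.range fun i => dd R (x i))) : extDer R B m = 0 := by
  induction hm using Submonoid.closure_induction with
  | mem m h => obtain ⟨i, rfl⟩ := h; exact extDer_dd _
  | one => exact extDer_one
  | mul m m' _ _ h h' => rw [extDer_mul, h, h', mul_zero, zero_mul, add_zero]

include hx in
-- A product of `dxᵢ`'s has as coefficient the determinant of a 0–1 matrix, or `0` in the wrong
-- degree. What matters is that an integer is killed by every `∂ᵢ`.
lemma exists_topCoeff_eq_intCast {m : Forms R B}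
    (hm : m ∈ Submonoid.closure (Set.range fun i => dd R (x i))) :
    ∃ c : ℤ, topCoeff b m = c := by
  obtain ⟨l, hl, rfl⟩ := Submonoid.exists_list_of_mem_closure hm
  have hl' : ∀ k : Fin l.length, ∃ i, dd R (x i) = l.get k := fun k => hl _ (l.get_mem k)
  choose f hf using hl'
  have e : l.prod = ExteriorAlgebra.ιMulti B l.length (fun k => b (f k)) := by
    rw [ExteriorAlgebra.ιMulti_apply]
    conv_lhs => rw [← List.ofFn_get l]
    congr 2
    funext k
    rw [← hf k, dd, hx]
  rw [e]
  clear e hf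
  -- With the list forgotten, the degree is a free variable that can be replaced by `n`.
  generalize l.length = k at f
  by_cases h : k = n
  · subst h
    refine ⟨(Matrix.of fun i j => if f j = i then (1 : ℤ) else 0).det, ?_⟩
    rw [topCoeff_ιMulti, Module.Basis.det_apply, Int.cast_det]
    congr 1
    ext i j
    simp [Module.Basis.toMatrix_apply, Finsupp.single_apply]
  · refine ⟨0, ?_⟩
    rw [topCoeff, ExteriorAlgebra.liftAlternating_apply_ιMulti, Pi.single_eq_of_ne h]
    simp

include hx in
lemma adjoin_dd_coordinates : Algebra.adjoin B (Set.range fun i => dd R (x i)) = ⊤ := by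
  refine eq_top_iff.2 fun z _ => ?_
  induction z using forms_induction with
  | halg a => exact Subalgebra.algebraMap_mem _ a
  | hdd a =>
    rw [dd_eq_sum_partialDer hx]
    exact Subalgebra.sum_mem _ fun i _ =>
      Subalgebra.smul_mem _ (Algebra.subset_adjoin (Set.mem_range_self i)) _
  | hmul y z hy hz => exact Subalgebra.mul_mem _ (hy trivial) (hz trivial)
  | hadd y z hy hz => exact Subalgebra.add_mem _ (hy trivial) (hz trivial)

/-- The operator `∏ ∂ᵢ ^ (p - 1)` vanishes on the coefficients of exact top forms. -/
lemma topDiffOp_topCoeff_extDer (p : ℕ) [Fact p.Prime] [CharP R p] (z : Forms R B) :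
    topDiffOp p hx Finset.univ (topCoeff b (extDer R B z)) = 0 := by
  have hz : z ∈ Submodule.span B
      (Submonoid.closure (Set.range fun i => dd R (x i)) : Set (Forms R B)) := by
    rw [← Algebra.adjoin_eq_span, adjoin_dd_coordinates hx]
    trivial
  -- Since `d` is not `B`-linear, the scalar `a` is built into the claim; scalar multiples in the
  -- induction are then absorbed into it.
  suffices h : ∀ a : B, topDiffOp p hx Finset.univ (topCoeff b (extDer R B (a • z))) = 0 by
    simpa using h 1
  induction hz using Submodule.span_induction with
  | mem m hm =>
    intro a
    rw [extDer_smul, extDer_eq_zero_of_mem_closure hm, smul_zero, zero_add,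
      dd_eq_sum_partialDer hx a, Finset.sum_mul, map_sum, map_sum]
    refine Finset.sum_eq_zero fun i _ => ?_
    -- For a product `m` of `dxᵢ`'s one has `d(a m) = ∑ ∂ᵢa dxᵢ ∧ m`, with coefficients integer
    -- multiples of the `∂ᵢa`, which the operator annihilates.
    obtain ⟨c, hc⟩ := exists_topCoeff_eq_intCast hx
      (mul_mem (Submonoid.subset_closure (Set.mem_range_self i)) hm)
    rw [smul_mul_assoc, map_smul, hc, smul_eq_mul, mul_comm, topDiffOp_mul_of_constant,
      topDiffOp_partialDer, mul_zero]
    simp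
  | zero => simp
  | add y z _ _ hy hz => simp [hy, hz]
  | smul c m hm ih => intro a; rw [smul_smul]; exact ih _

end TopCoefficient

end Coordinates

/-! ### Pullback of forms, used to move an exactness relation to a chart. -/

section FormsMap

variable (R A B : Type*) [CommRing R] [CommRing A] [CommRing B] [Algebra R A] [Algebra R B]
  [Algebra A B] [IsScalarTower R A B]

/-- The pullback of differential forms along `A → B`. -/
noncomputable def formsMap : Forms R A →ₐ[A] Forms R B :=
  ExteriorAlgebra.lift A
    ⟨(ExteriorAlgebra.ι B).restrictScalars A ∘ₗ KaehlerDifferential.map R R A B, fun m => by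
      simp⟩

variable {R A B}

lemma formsMap_ι (m : Ω[A⁄R]) : formsMap R A B (ExteriorAlgebra.ι A m) =
    ExteriorAlgebra.ι B (KaehlerDifferential.map R R A B m) := by
  rw [formsMap, ExteriorAlgebra.lift_ι_apply]
  rfl

lemma formsMap_algebraMap (a : A) :
    formsMap R A B (algebraMap A _ a) = algebraMap B _ (algebraMap A B a) := by
  rw [AlgHom.commutes]
  rfl

lemma formsMap_dd (a : A) : formsMap R A B (dd R a) = dd R (algebraMap A B a) := by
  rw [dd, formsMap_ι, KaehlerDifferential.map_D]
  rfl

lemma formsMap_sgn (z : Forms R A) :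
    formsMap R A B (sgn R A z) = sgn R B (formsMap R A B z) := by
  induction z using ExteriorAlgebra.induction with
  | algebraMap r => simp
  | ι m => simp [formsMap_ι]
  | mul a b ha hb => simp [ha, hb]
  | add a b ha hb => simp [ha, hb]

lemma formsMap_extDer (z : Forms R A) :
    formsMap R A B (extDer R A z) = extDer R B (formsMap R A B z) := by
  induction z using forms_induction with
  | halg a => rw [extDer_algebraMap, formsMap_algebraMap, extDer_algebraMap, formsMap_dd]
  | hdd a => rw [extDer_dd, formsMap_dd, extDer_dd, map_zero]
  | hmul y z hy hz => simp only [extDer_mul, map_mul, map_add, formsMap_sgn, hy, hz]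
  | hadd y z hy hz => simp only [map_add, hy, hz]

lemma formsMap_ιMulti {n : ℕ} (v : Fin n → Ω[A⁄R]) :
    formsMap R A B (ExteriorAlgebra.ιMulti A n v) =
      ExteriorAlgebra.ιMulti B n fun i => KaehlerDifferential.map R R A B (v i) := by
  rw [ExteriorAlgebra.ιMulti_apply, ExteriorAlgebra.ιMulti_apply, map_list_prod, List.map_ofFn]
  simp only [Function.comp_def, formsMap_ι]

end FormsMap

/-! ### The inverse Cartier operator on top forms. -/

section InverseCartier

variable {p : ℕ} {R A : Type*} [CommRing R] [CommRing A] [Algebra R A]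

lemma coe_prod_gammaForm {n : ℕ} (x : Fin n → A) :
    ((List.ofFn fun i => gammaForm p R (x i)).prod : Forms R A) = (∏ i, x i ^ (p - 1)) •
      ExteriorAlgebra.ιMulti A n fun i => KaehlerDifferential.D R A (x i) := by
  rw [← AlternatingMap.map_smul_univ, ExteriorAlgebra.ιMulti_apply,
    ← Subring.subtype_apply, map_list_prod, List.map_ofFn]
  simp [Function.comp_def, gammaForm, dd]

variable [Fact p.Prime] [CharP R p]

/-- `c (dx₁ ∧ ⋯ ∧ dxₙ)` is the class of `(x₁ ⋯ xₙ) ^ (p - 1) dx₁ ∧ ⋯ ∧ dxₙ`. -/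
lemma invCartier_ιMulti {n : ℕ} (x : Fin n → A) :
    invCartier p R A (ExteriorAlgebra.ιMulti A n fun i => KaehlerDifferential.D R A (x i)) =
      twClass p R A (List.ofFn fun i => gammaForm p R (x i)).prod := by
  rw [ExteriorAlgebra.ιMulti_apply, map_list_prod, map_list_prod, List.map_ofFn, List.map_ofFn]
  congr 2
  funext i
  rw [Function.comp_apply, invCartier, ExteriorAlgebra.lift_ι_apply,
    Derivation.liftKaehlerDifferential_comp_D]
  rfl

/-- If `dx₁ ∧ ⋯ ∧ dxₙ = w τ` and `C (h τ) = f τ`, then `w ^ p h τ` and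
`f ^ p (x₁ ⋯ xₙ) ^ (p - 1) dx₁ ∧ ⋯ ∧ dxₙ` differ by an exact form. -/
lemma IsCartier.exists_extDer_eq {n : ℕ} {x : Fin n → A} {τ : Forms R A} {w f h : A}
    (hw : (ExteriorAlgebra.ιMulti A n fun i => KaehlerDifferential.D R A (x i)) = w • τ)
    (hC : IsCartier p R A (h • τ) (f • τ)) :
    ∃ z, extDer R A z = (f ^ p * ∏ i, x i ^ (p - 1)) •
      (ExteriorAlgebra.ιMulti A n fun i => KaehlerDifferential.D R A (x i)) -
        (w ^ p * h) • τ := by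
  obtain ⟨hcl, hC⟩ := hC
  -- Both sides are the image of `f dx₁ ∧ ⋯ ∧ dxₙ = w f τ` under the inverse Cartier operator, with
  -- either `f` or `w` pulled out as a `p`-th power.
  have e : twClass p R A (powClosed p R A f * (List.ofFn fun i => gammaForm p R (x i)).prod) =
      twClass p R A (powClosed p R A w * ⟨h • τ, hcl⟩) := by
    rw [← smul_twClass, ← smul_twClass, ← hC, ← invCartier_ιMulti, hw, map_smul, map_smul,
      smul_comm]
  obtain ⟨z, hz⟩ := cohClass_eq_iff.1 e
  refine ⟨z, ?_⟩
  rw [hz, Subring.coe_mul, Subring.coe_mul, coe_prod_gammaForm]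
  simp only [powClosed, RingHom.coe_mk, MonoidHom.coe_mk, OneHom.coe_mk, ← Algebra.smul_def,
    smul_smul]

end InverseCartier

/-! ### Divisibility of `p`-th powers on a coordinate chart. -/

section Local

variable {p : ℕ} [hp : Fact p.Prime] {R A B : Type*} [CommRing R] [CommRing A] [CommRing B]
  [Algebra R A] [Algebra R B] [Algebra A B] [IsScalarTower R A B] [CharP R p]

/-- A Bézout relation between `p` and `(p - 1)!` becomes an inverse of `(p - 1)!` once `p = 0`. -/
lemma isUnit_natCast_factorial (hB : (p : B) = 0) : IsUnit ((p - 1).factorial : B) := by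
  have h : p.Coprime (p - 1).factorial :=
    (Nat.coprime_factorial_iff hp.out.one_lt.ne').2 (by
      rw [hp.out.minFac_eq]; exact Nat.sub_lt hp.out.pos one_pos)
  obtain ⟨c, hc⟩ := Nat.isCoprime_iff_coprime.2 h
  obtain ⟨d, hc⟩ := hc
  have := congrArg (Int.cast : ℤ → B) hc
  push_cast at this
  rw [hB, mul_zero, zero_add] at this
  exact IsUnit.of_mul_eq_one_right _ this

/-- Applying `∏ ∂ᵢ ^ (p - 1)` to the pulled-back exactness relation leaves `f ^ p` times a unit on
one side and `g ^ p` times something on the other. The Cartier relation itself stays on `A`; only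
exactness passes to `B`. -/
lemma IsCartier.pow_dvd_pow_of_coordinates {n : ℕ} {b : Module.Basis (Fin n) B Ω[B⁄R]}
    {x : Fin n → A} (hx : ∀ i, b i = KaehlerDifferential.D R B (algebraMap A B (x i)))
    {τ : Forms R A} {w f g c : A}
    (hw : (ExteriorAlgebra.ιMulti A n fun i => KaehlerDifferential.D R A (x i)) = w • τ)
    (hC : IsCartier p R A ((g ^ p * c) • τ) (f • τ)) :
    algebraMap A B g ^ p ∣ algebraMap A B f ^ p := by
  obtain ⟨z, hz⟩ := hC.exists_extDer_eq hw
  have key := topDiffOp_topCoeff_extDer hx p (formsMap R A B z)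
  have hb : (fun i => KaehlerDifferential.map R R A B (KaehlerDifferential.D R A (x i))) = b := by
    funext i
    rw [hx, KaehlerDifferential.map_D]
  have hpow (a e : B) : topDiffOp p hx Finset.univ (a ^ p * e) =
      a ^ p * topDiffOp p hx Finset.univ e :=
    topDiffOp_mul_of_constant hx p _ (fun i _ => by simp [Derivation.leibniz_pow, cast_p p R B]) e
  rw [← formsMap_extDer, hz, map_sub, map_smul, map_smul, formsMap_ιMulti, hb,
    ← algebraMap_smul B, ← algebraMap_smul B (w ^ p * _), map_sub, map_smul, map_smul,
    topCoeff_ιMulti, Module.Basis.det_self, map_sub, smul_eq_mul, smul_eq_mul, mul_one,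
    map_mul, map_pow, hpow, map_prod] at key
  simp only [map_pow] at key
  rw [topDiffOp_prod_coordinates, show algebraMap A B (w ^ p * (g ^ p * c)) *
      topCoeff b (formsMap R A B τ) = algebraMap A B g ^ p *
        (algebraMap A B (w ^ p * c) * topCoeff b (formsMap R A B τ)) by
          simp only [map_mul, map_pow]; ring,
    hpow, sub_eq_zero] at key
  exact (((isUnit_natCast_factorial (cast_p p R B)).pow _).dvd_mul_right).1 (Dvd.intro _ key.symm)

end Local

/-! ### Covering a smooth algebra by coordinate charts. -/

section Cover

variable {R A : Type*} [CommRing R] [CommRing A] [Algebra R A]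

/-- Denominators are cleared by `φ ^ (m * p)`: a `p`-th power has zero differential, so `dy` is
merely rescaled by a unit and the basis remains one of exact differentials. Coordinates from `A` are
needed because the Cartier relation lives there. -/
lemma exists_basis_range_subset_algebraMap (B : Type*) [CommRing B] [Algebra R B] [Algebra A B]
    [IsScalarTower R A B] (φ : A) [IsLocalization.Away φ B] {ι : Type*} [Finite ι]
    (b : Module.Basis ι B Ω[B⁄R]) {p : ℕ} [Fact p.Prime] [CharP R p]
    (hb : Set.range b ⊆ Set.range (KaehlerDifferential.D R B)) :
    ∃ (b' : Module.Basis ι B Ω[B⁄R]) (x : ι → A),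
      ∀ i, b' i = KaehlerDifferential.D R B (algebraMap A B (x i)) := by
  have h : ∀ i, ∃ (x : A) (u : Bˣ),
      (u : B) • b i = KaehlerDifferential.D R B (algebraMap A B x) := by
    intro i
    obtain ⟨y, hy⟩ := hb (Set.mem_range_self i)
    obtain ⟨m, a, ha⟩ := IsLocalization.Away.surj φ y
    have hφ : IsUnit (algebraMap A B φ) := IsLocalization.Away.algebraMap_isUnit φ
    have e : y * algebraMap A B φ ^ (m * p) = algebraMap A B (a * φ ^ (m * p - m)) := by
      rw [map_mul, map_pow, ← ha, mul_assoc, ← pow_add,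
        Nat.add_sub_cancel' (Nat.le_mul_of_pos_right _ (Fact.out : p.Prime).pos)]
    refine ⟨a * φ ^ (m * p - m), (hφ.pow (m * p)).unit, ?_⟩
    rw [← e, Derivation.leibniz, hy, IsUnit.unit_spec, Derivation.leibniz_pow]
    have : ((m * p : ℕ) : B) = 0 := by rw [Nat.cast_mul, cast_p p R B, mul_zero]
    rw [← Nat.cast_smul_eq_nsmul B, this, zero_smul, smul_zero, zero_add]
  choose x u hu using h
  exact ⟨b.unitsSMul u, x, fun i => by rw [Module.Basis.unitsSMul_apply, ← hu]; rfl⟩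

/-- Differentials commute with étale base change, so the rank over `B` at a prime is the rank over
`A` at its contraction. -/
lemma card_basis_eq_of_rankAtStalk [Module.Finite A Ω[A⁄R]]
    [Module.Flat A Ω[A⁄R]] {n : ℕ}
    (hn : ∀ P : PrimeSpectrum A, Module.rankAtStalk (R := A) Ω[A⁄R] P = n)
    (B : Type*) [CommRing B] [Nontrivial B] [Algebra R B] [Algebra A B] [IsScalarTower R A B]
    [Algebra.FormallyEtale A B] {ι : Type*} [Finite ι] (b : Module.Basis ι B Ω[B⁄R]) :
    Nat.card ι = n := by
  have := Module.Free.of_basis b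
  have := Module.Finite.of_basis b
  let P : PrimeSpectrum B := Classical.arbitrary _
  rw [← Module.finrank_eq_nat_card_basis b,
    ← hn (P.comap (algebraMap A B)),
    ← Module.rankAtStalk_isBaseChange (KaehlerDifferential.isBaseChange_of_formallyEtale R A B) P,
    Module.rankAtStalk_eq_finrank_of_free]
  rfl

/-- A smooth algebra is locally étale over an affine space: it has local coordinates. -/
lemma span_coordinates_eq_top (p : ℕ) [Fact p.Prime] [CharP R p] [Algebra.Smooth R A] {n : ℕ}
    (hn : ∀ P : PrimeSpectrum A, Module.rankAtStalk (R := A) Ω[A⁄R] P = n) :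
    Ideal.span {φ : A | ∃ (x : Fin n → A)
      (b : Module.Basis (Fin n) (Localization.Away φ) Ω[Localization.Away φ⁄R]),
      ∀ i, b i = KaehlerDifferential.D R (Localization.Away φ) (algebraMap A _ (x i))} = ⊤ := by
  obtain ⟨s, hs, h⟩ := Algebra.Smooth.exists_span_eq_top_isStandardSmooth R A
  refine eq_top_iff.2 (hs ▸ Ideal.span_mono fun φ hφ => ?_)
  have hst := h φ hφ
  rcases subsingleton_or_nontrivial (Localization.Away φ) with hB | hB
  -- Over the zero ring the rank is undetermined, and a basis indexed by `Fin n` is supplied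
  -- directly.
  · have : Subsingleton Ω[Localization.Away φ⁄R] := Module.subsingleton (Localization.Away φ) _
    exact ⟨0, .ofRepr 0, fun _ => Subsingleton.elim _ _⟩
  · obtain ⟨-, ι, b, hb⟩ := Algebra.IsStandardSmooth.iff_exists_basis_kaehlerDifferential.1 hst
    have : Finite ι := Module.Finite.finite_basis b
    have : Algebra.FormallyEtale A (Localization.Away φ) :=
      Algebra.FormallyEtale.of_isLocalization (Submonoid.powers φ)
    have e := Finite.equivFinOfCardEq (card_basis_eq_of_rankAtStalk hn _ b)
    obtain ⟨b', x, h'⟩ := exists_basis_range_subset_algebraMap (p := p) _ φ b hb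
    exact ⟨x ∘ e.symm, b'.reindex e, fun i => by rw [b'.reindex_apply, h']; rfl⟩

end Cover

/-! ### Extracting `p`-th roots with the splitting, and gluing. -/

section Splitting

variable {p : ℕ} {R A : Type*} [CommRing R] [CommRing A] [Algebra R A]

/-- A Frobenius splitting of `A` detects divisibility of `p`-th powers. -/
lemma TwistedEnd.dvd_of_pow_dvd_pow (s : TwistedEnd p A) (hs : ∀ a, s.toAddMonoidHom (a ^ p) = a)
    {f g : A} (h : g ^ p ∣ f ^ p) : g ∣ f := by
  obtain ⟨v, hv⟩ := h
  exact ⟨s.toAddMonoidHom v, by rw [← hs f, hv]; exact s.map_pow_mul' g v⟩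

variable [hp : Fact p.Prime]

/-- The splitting is given on `A` rather than on the localization, so denominators are cleared
before taking the root. -/
lemma exists_pow_mul_dvd_of_away (s : TwistedEnd p A) (hs : ∀ a, s.toAddMonoidHom (a ^ p) = a)
    (φ : A) {B : Type*} [CommRing B] [Algebra A B] [IsLocalization.Away φ B] {f g : A}
    (h : algebraMap A B g ^ p ∣ algebraMap A B f ^ p) : ∃ N, g ∣ φ ^ N * f := by
  obtain ⟨v, hv⟩ := h
  obtain ⟨m, a, ha⟩ := IsLocalization.Away.surj φ v
  have e : algebraMap A B (φ ^ m * f ^ p) = algebraMap A B (g ^ p * a) := by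
    rw [map_mul, map_mul, map_pow, map_pow, map_pow, hv, ← ha]
    ring
  obtain ⟨N, hN⟩ := IsLocalization.Away.exists_of_eq φ e
  -- The factor `φ ^ ((m + N) * (p - 1))` completes `φ ^ (m + N) * f ^ p` to the `p`-th power of `φ
  -- ^ (m + N) * f`.
  refine ⟨m + N, s.dvd_of_pow_dvd_pow hs ⟨φ ^ ((m + N) * (p - 1)) * φ ^ N * a, ?_⟩⟩
  obtain ⟨q, rfl⟩ : ∃ q, p = q + 1 := ⟨p - 1, by have := hp.out.pos; omega⟩
  rw [Nat.add_sub_cancel]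
  linear_combination φ ^ ((m + N) * q) * hN

/-- If `C (g ^ p c τ) = f τ` for a generator `τ` of the top forms and `A` has a Frobenius
splitting, then `g` divides `f`. -/
lemma IsCartier.dvd [CharP R p] [Algebra.Smooth R A] {n : ℕ}
    (hn : ∀ P : PrimeSpectrum A, Module.rankAtStalk (R := A) Ω[A⁄R] P = n)
    (s : TwistedEnd p A) (hs : ∀ a, s.toAddMonoidHom (a ^ p) = a)
    {τ : Forms R A} (hτ : ∀ v : Fin n → Ω[A⁄R], ∃ w : A, ExteriorAlgebra.ιMulti A n v = w • τ)
    {f g c : A} (hC : IsCartier p R A ((g ^ p * c) • τ) (f • τ)) : g ∣ f := by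
  -- This is the colon ideal `(g : f)`. Its radical contains every `φ` defining a chart, and these
  -- generate the unit ideal.
  let J : Ideal A := Submodule.comap (LinearMap.mulRight A f) (Ideal.span {g})
  have hJ (a : A) : a ∈ J ↔ g ∣ a * f := by
    simp [J, Ideal.mem_span_singleton]
  have hrad : J.radical = ⊤ := by
    rw [eq_top_iff, ← span_coordinates_eq_top p hn, Ideal.span_le]
    rintro φ ⟨x, b, hx⟩
    obtain ⟨w, hw⟩ := hτ fun i => KaehlerDifferential.D R A (x i)
    obtain ⟨N, hN⟩ := exists_pow_mul_dvd_of_away s hs φ (hC.pow_dvd_pow_of_coordinates hx hw)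
    exact ⟨N, (hJ _).2 hN⟩
  have h1 := (hJ 1).1 ((Ideal.eq_top_iff_one J).1 (Ideal.radical_eq_top.1 hrad))
  rwa [one_mul] at h1

end Splitting

section DualPower

open scoped TensorProduct

variable {A L : Type*} [CommRing A] [AddCommGroup L] [Module A L]

lemma dualPow_tprod (p : ℕ) [hp : Fact p.Prime] (σ : L →ₗ[A] A) (τ : L) :
    dualPow p σ (PiTensorProduct.tprod A fun _ : Fin p => τ) = σ τ ^ (p - 1) • τ := by
  rw [dualPow, LinearMap.comp_apply, LinearEquiv.coe_coe, TensorPower.cast_tprod, dualPowSucc,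
    PiTensorProduct.lift.tprod]
  simp [MultilinearMap.mkPiAlgebra_apply, Fin.init]

end DualPower

/-! ### Passage from the scheme to its affine sections. -/

section Scheme

open AlgebraicGeometry CategoryTheory

variable {F : Type u} [Field F] {X : Scheme.{u}} [X.Over (Spec (.of F))]

lemma smooth_sections [Smooth (X ↘ Spec (.of F))] {U : X.Opens} (hU : IsAffineOpen U) :
    Algebra.Smooth F Γ(X, U) := by
  have h : (algebraMap F Γ(X, U)).Smooth :=
    (RingHom.Smooth.of_bijective
      (ConcreteCategory.bijective_of_isIso (Scheme.ΓSpecIso (.of F)).inv)).comp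
      ((X ↘ Spec (.of F)).smooth_appLE (isAffineOpen_top _) hU
        (by rw [Scheme.Hom.preimage_top]; exact le_top))
  exact RingHom.smooth_algebraMap.1 h

lemma PureAffine.IsGenerator.exists_smul_eq {n : ℕ} {U : PureAffine F X n} {τ : U.can}
    (hτ : U.IsGenerator τ) (v : Fin n → Ω[Γ(X, U.U)⁄F]) :
    ∃ w : Γ(X, U.U), ExteriorAlgebra.ιMulti Γ(X, U.U) n v = w • (τ : Forms F Γ(X, U.U)) := by
  have h : exteriorPower.ιMulti Γ(X, U.U) n v ∈ Submodule.span Γ(X, U.U) {τ} := by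
    rw [show Submodule.span Γ(X, U.U) {τ} = ⊤ from hτ]
    trivial
  obtain ⟨w, hw⟩ := Submodule.mem_span_singleton.1 h
  exact ⟨w, (congrArg Subtype.val hw).symm⟩

end Scheme

end FrobSplit

theorem mainTheorem12 (p : ℕ) [Fact p.Prime] (F : Type u) [Field F] [IsAlgClosed F] [CharP F p]
    (X : AlgebraicGeometry.Scheme.{u}) [X.Over (AlgebraicGeometry.Spec (.of F))]
    [AlgebraicGeometry.Smooth (X ↘ AlgebraicGeometry.Spec (.of F))]
    (σ : FrobSplit.AnticanonicalSection F X) (s : FrobSplit.FrobEnd p X)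
    (hσs : σ.PowDefines s) (hs : s.IsSplitting) :
    s.IsCompatible σ.divIdeal := by
  intro U a ha
  simp only [FrobSplit.AnticanonicalSection.divIdeal, Submodule.mem_iInf, Ideal.mem_comap,
    Ideal.mem_span_singleton] at ha ⊢
  intro n V h τ hτ
  obtain ⟨c, hc⟩ := ha n V h τ hτ
  have := FrobSplit.smooth_sections (F := F) V.isAffine
  have hC := hσs V τ hτ (σ.app V τ * c)
  -- The `p - 1` factors `σ(τ)` from `σ ^ (p - 1)` and the one from membership in the ideal make a
  -- full `p`-th power.
  have hpow : (σ.app V τ * c) * σ.app V τ ^ (p - 1) = σ.app V τ ^ p * c := by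
    rw [mul_right_comm, mul_pow_sub_one (Fact.out : p.Prime).ne_zero]
  rw [map_smul, FrobSplit.dualPow_tprod, smul_smul, hpow] at hC
  rw [s.naturality, hc]
  exact FrobSplit.IsCartier.dvd V.rank (s.app V.U) (hs V.U) hτ.exists_smul_eq hC
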